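/- All groups, $G$-sets and bisets are finite. Let $R$ be a commutative ring with identity and let $\mathcal Z$ be a non-empty class of groups closed under direct products and under subquotients (homomorphic images of subgroups of members of $\mathcal Z$ belong to $\mathcal Z$). Let $\Omega_{R,\mathcal Z}$ be the biset category: its objects are the groups in $\mathcal Z$, $\mathrm{Hom}(G,H)=RB(H,G)=R\otimes_{\mathbb Z}B(H,G)$ with $B(H,G)$ the Grothendieck group of $(H,G)$-bisets (for disjoint union), the composition is the bilinear extension of $(V,U)\mapsto V\times_H U$, and the identity of $G$ is the $(G,G)$-biset $G$. Cartesian products of bisets induce bilinear maps $RB(H,G)\times RB(H',G')\to RB(H\times H',G\times G')$, $(\varphi,\psi)\mapsto\varphi\times\psi$; for a group $K$, $\varphi\times K$ and $K\times\varphi$ denote the products with the $(K,K)$-biset $K$. For a group isomorphism $f:G\to H$, $\mathrm{Iso}(f)$ is the $(H,G)$-biset $H$ with $G$ acting through $f$; for $D\leqslant G$, $\mathrm{Res}_D^G$ is the $(D,G)$-biset $G$; $\mathrm{Inf}_1^{1\times C}$ is the one-point $(1\times C,1)$-biset. A *biset functor* is an $R$-linear functor $\Omega_{R,\mathcal Z}\to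 R\text{-Mod}$. A *Green biset functor* is a biset functor $A$ with $R$-bilinear products $A(G)\times A(H)\to A(G\times H)$, $(a,b)\mapsto a\times b$, for $G,H\in\mathcal Z$, and an element $\varepsilon_A\in A(1)$, such that: * $(a\times b)\times c=A(\mathrm{Iso}(\alpha))\bigl(a\times(b\times c)\bigr)$ for $a\in A(G)$, $b\in A(H)$, $c\in A(K)$, with $\alpha:G\times(H\times K)\to(G\times H)\times K$ the canonical isomorphism; * $a=A(\mathrm{Iso}(\lambda_G))(\varepsilon_A\times a)=A(\mathrm{Iso}(\rho_G))(a\times\varepsilon_A)$ for $a\in A(G)$, with $\lambda_G:1\times G\to G$ and $\rho_G:G\times1\to G$ the canonical isomorphisms; * $A(\varphi\times\psi)(a\times b)=A(\varphi)(a)\times A(\psi)(b)$ for all morphisms $\varphi:G\to G'$, $\psi:H\to H'$ of $\Omega_{R,\mathcal Z}$ and all $a\in A(G)$, $b\in A(H)$. **Lemma.** Let $A$ be a Green biset functor on $\Omega_{R,\mathcal Z}$ and let $C\in\mathcal Z$. The Yoneda–Dress construction $A_C$, given by $A_C(G)=A(G\times C)$ for $G\in\mathcal Z$ and $A_C(\varphi)=A(\varphi\times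 C)$ for morphisms $\varphi$ of $\Omega_{R,\mathcal Z}$, is a Green biset functor on $\Omega_{R,\mathcal Z}$ with the following products and identity element. For $K,G\in\mathcal Z$ the product of $A_C$ is the composite $$A_C(K)\times A_C(G)\xrightarrow{\ \times_A\ }A(K\times C\times G\times C)\xrightarrow{\ A(K\times X_C^G)\ }A(K\times G\times C)=A_C(K\times G),$$ where $\times_A$ is the product of $A$, $X_C^G=\mathrm{Iso}(f)\times_D\mathrm{Res}_D^{C\times G\times C}$, $D=\{(c,g,c)\mid c\in C,\ g\in G\}$, $f:D\to G\times C$ is the isomorphism $(c,g,c)\mapsto(g,c)$, and the canonical isomorphisms that rebracket direct products are understood. The identity element is $\varepsilon_{A_C}=A(\mathrm{Inf}_1^{1\times C})(\varepsilon_A)\in A_C(1)$. -/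

import Mathlib

open CategoryTheory TensorProduct MulOpposite

universe u v w

/-- A finite `(H, G)`-biset: a finite set with a left action of `H` and a right action of `G`
(an action of the opposite group `Gᵐᵒᵖ`, so that `op g • x` is `x · g`) which commute. -/
structure FinBiset (H G : Type u) [Group H] [Group G] where
  carrier : Type u
  [finite : Finite carrier]
  [left : MulAction H carrier]
  [right : MulAction Gᵐᵒᵖ carrier]
  [comm : SMulCommClass H Gᵐᵒᵖ carrier]

namespace FinBiset

instance (H G : Type u) [Group H] [Group G] : CoeSort (FinBiset H G) (Type u) := ⟨carrier⟩

attribute [instance] finite left right comm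

section Basic

variable {H G : Type u} [Group H] [Group G]

/-- Isomorphisms of `(H, G)`-bisets: equivariant bijections. -/
structure Iso (X Y : FinBiset H G) extends X ≃ Y where
  map_left : ∀ (h : H) (x : X), toFun (h • x) = h • toFun x
  map_right : ∀ (g : G) (x : X), toFun (op g • x) = op g • toFun x

/-- The isomorphism relation on finite `(H, G)`-bisets. -/
instance isoSetoid (H G : Type u) [Group H] [Group G] : Setoid (FinBiset H G) where
  r X Y := Nonempty (Iso X Y)
  iseqv :=
    { refl := fun X => ⟨⟨Equiv.refl X, fun _ _ => rfl, fun _ _ => rfl⟩⟩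
      symm := by
        rintro X Y ⟨e⟩
        refine ⟨⟨e.toEquiv.symm, fun h y => ?_, fun g y => ?_⟩⟩
        · obtain ⟨x, rfl⟩ := e.toEquiv.surjective y
          apply e.toEquiv.injective
          have := e.map_left h x
          simp_all
        · obtain ⟨x, rfl⟩ := e.toEquiv.surjective y
          apply e.toEquiv.injective
          have := e.map_right g x
          simp_all
      trans := by
        rintro X Y Z ⟨e⟩ ⟨f⟩
        refine ⟨⟨e.toEquiv.trans f.toEquiv, fun h x => ?_, fun g x => ?_⟩⟩
        · exact (congrArg f.toFun (e.map_left h x)).trans (f.map_left h _)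
        · exact (congrArg f.toFun (e.map_right g x)).trans (f.map_right g _) }

/-- A bijective equivariant map shows that two bisets are isomorphic. -/
theorem equiv_of_bijective {X Y : FinBiset H G} (f : X → Y) (hf : Function.Bijective f)
    (hl : ∀ (h : H) (x : X), f (h • x) = h • f x)
    (hr : ∀ (g : G) (x : X), f (op g • x) = op g • f x) : X ≈ Y :=
  ⟨⟨Equiv.ofBijective f hf, hl, hr⟩⟩

/-- The empty biset. -/
def empty (H G : Type u) [Group H] [Group G] : FinBiset H G where
  carrier := PEmpty
  left := { smul := fun _ x => x, one_smul := fun _ => rfl, mul_smul := fun _ _ _ => rfl }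
  right := { smul := fun _ x => x, one_smul := fun _ => rfl, mul_smul := fun _ _ _ => rfl }
  comm := @SMulCommClass.mk _ _ _ (_) (_) fun _ _ x => x.elim

/-- The disjoint union of two bisets. -/
def sum (X Y : FinBiset H G) : FinBiset H G where
  carrier := X ⊕ Y

/-- If `a : H → L` and `b : G → L` are group homomorphisms and `L` is finite, the set `L` is an
`(H, G)`-biset for `h · l · g = a h * l * b g`. -/
def ofHoms {L : Type u} [Group L] [Finite L] (a : H →* L) (b : G →* L) : FinBiset H G where
  carrier := L
  left :=
    { smul := fun h l => a h * l
      one_smul := fun l => by change a 1 * l = l; simp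
      mul_smul := fun h h' l => by change a (h * h') * l = a h * (a h' * l); simp [mul_assoc] }
  right :=
    { smul := fun g l => l * b g.unop
      one_smul := fun l => by change l * b 1 = l; simp
      mul_smul := fun g g' l => by
        change l * b (g'.unop * g.unop) = l * b g'.unop * b g.unop; simp [mul_assoc] }
  comm := @SMulCommClass.mk _ _ _ (_) (_) fun h g l => (mul_assoc (a h) l (b g.unop)).symm

/-- The identity `(G, G)`-biset `G`. -/
def ident (G : Type u) [Group G] [Finite G] : FinBiset G G :=
  ofHoms (MonoidHom.id G) (MonoidHom.id G)

/-- `Iso(f)` for a group isomorphism `f : G → H`: the `(H, G)`-biset `H`,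
with `h · x · g = h * x * f g`. -/
def iso [Finite H] (f : G ≃* H) : FinBiset H G :=
  ofHoms (MonoidHom.id H) f.toMonoidHom

/-- `Res_D^G`: the `(D, G)`-biset `G`. -/
def res [Finite G] (D : Subgroup G) : FinBiset D G :=
  ofHoms D.subtype (MonoidHom.id G)

/-- Inflation along a surjective homomorphism `p : G → Q`, that is, from the quotient `Q` of `G`
to `G`: the `(G, Q)`-biset `Q`. -/
def inf {Q : Type u} [Group Q] [Finite Q] (p : G →* Q) (_hp : Function.Surjective p) :
    FinBiset G Q :=
  ofHoms p (MonoidHom.id Q)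

end Basic

section Comp

variable {L K H G : Type u} [Group L] [Group K] [Group H] [Group G]

/-- The orbit relation of `H` acting on the right of `V × U` by
`(v, u) · h = (v · h, h⁻¹ · u)`. -/
def compSetoid (V : FinBiset K H) (U : FinBiset H G) : Setoid (V × U) where
  r p q := ∃ h : H, q = (op h • p.1, h⁻¹ • p.2)
  iseqv :=
    { refl := fun p => ⟨1, by simp⟩
      symm := by
        rintro p q ⟨h, rfl⟩
        exact ⟨h⁻¹, by simp⟩
      trans := by
        rintro p q r ⟨h, rfl⟩ ⟨h', rfl⟩
        exact ⟨h * h', by simp [mul_smul]⟩ }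

/-- The composition `V ×_H U` of a `(K, H)`-biset `V` and an `(H, G)`-biset `U`: the set of
`H`-orbits on `V × U`, with `k · [v, u] · g = [k · v, u · g]`. -/
def comp (V : FinBiset K H) (U : FinBiset H G) : FinBiset K G where
  carrier := Quotient (compSetoid V U)
  left :=
    { smul := fun k => Quotient.map (fun p => (k • p.1, p.2)) (by
        rintro p q ⟨h, rfl⟩
        exact ⟨h, Prod.ext (smul_comm k (op h) p.1) rfl⟩)
      one_smul := by rintro ⟨p⟩; exact congrArg (Quotient.mk (compSetoid V U)) (Prod.ext (one_smul K p.1) rfl)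
      mul_smul := by rintro k k' ⟨p⟩; exact congrArg (Quotient.mk (compSetoid V U)) (Prod.ext (mul_smul k k' p.1) rfl) }
  right :=
    { smul := fun g => Quotient.map (fun p => (p.1, g • p.2)) (by
        rintro p q ⟨h, rfl⟩
        exact ⟨h, Prod.ext rfl (smul_comm h⁻¹ g p.2).symm⟩)
      one_smul := by rintro ⟨p⟩; exact congrArg (Quotient.mk (compSetoid V U)) (Prod.ext rfl (one_smul Gᵐᵒᵖ p.2))
      mul_smul := by rintro k k' ⟨p⟩; exact congrArg (Quotient.mk (compSetoid V U)) (Prod.ext rfl (mul_smul k k' p.2)) }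
  comm := @SMulCommClass.mk _ _ _ (_) (_) (by rintro k g ⟨p⟩; rfl)

/-- The class `[v, u]` in `V ×_H U`. -/
def comp.mk (V : FinBiset K H) (U : FinBiset H G) (v : V) (u : U) : comp V U :=
  Quotient.mk (compSetoid V U) (v, u)

theorem comp.mk_eq_iff {V : FinBiset K H} {U : FinBiset H G} {v v' : V} {u u' : U} :
    comp.mk V U v u = comp.mk V U v' u' ↔ ∃ h : H, v' = op h • v ∧ u' = h⁻¹ • u := by
  refine ⟨fun h => ?_, ?_⟩
  · obtain ⟨h, hh⟩ := Quotient.exact h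
    exact ⟨h, congrArg Prod.fst hh, congrArg Prod.snd hh⟩
  · rintro ⟨h, rfl, rfl⟩
    exact Quotient.sound ⟨h, rfl⟩

theorem comp.ind {V : FinBiset K H} {U : FinBiset H G} {p : comp V U → Prop}
    (h : ∀ v u, p (comp.mk V U v u)) (x : comp V U) : p x :=
  Quotient.ind (fun q => h q.1 q.2) x

theorem comp.op_smul_mk (V : FinBiset K H) (U : FinBiset H G) (h : H) (v : V) (u : U) :
    comp.mk V U (op h • v) u = comp.mk V U v (h • u) :=
  comp.mk_eq_iff.2 ⟨h⁻¹, by simp⟩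

theorem comp.smul_mk (V : FinBiset K H) (U : FinBiset H G) (k : K) (v : V) (u : U) :
    k • comp.mk V U v u = comp.mk V U (k • v) u := rfl

theorem comp.mk_smul (V : FinBiset K H) (U : FinBiset H G) (g : G) (v : V) (u : U) :
    op g • comp.mk V U v u = comp.mk V U v (op g • u) := rfl

/-- Maps out of `V ×_H U`. -/
def comp.desc {V : FinBiset K H} {U : FinBiset H G} {T : Type*} (f : V → U → T)
    (hf : ∀ (h : H) v u, f (op h • v) u = f v (h • u)) (x : comp V U) : T :=
  Quotient.lift (fun p : V × U => f p.1 p.2) (by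
    rintro p q ⟨h, rfl⟩
    simp [hf]) x

theorem comp.desc_mk {V : FinBiset K H} {U : FinBiset H G} {T : Type*} (f : V → U → T)
    (hf : ∀ (h : H) v u, f (op h • v) u = f v (h • u)) (v : V) (u : U) :
    comp.desc f hf (comp.mk V U v u) = f v u := rfl

theorem equiv_of_maps {X Y : FinBiset H G} (f : X → Y) (g : Y → X)
    (hfg : ∀ x, g (f x) = x) (hgf : ∀ y, f (g y) = y)
    (hl : ∀ (h : H) (x : X), f (h • x) = h • f x)
    (hr : ∀ (g : G) (x : X), f (op g • x) = op g • f x) : X ≈ Y :=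
  ⟨⟨⟨f, g, hfg, hgf⟩, hl, hr⟩⟩

theorem comp_congr {V V' : FinBiset K H} {U U' : FinBiset H G} (hV : V ≈ V') (hU : U ≈ U') :
    comp V U ≈ comp V' U' := by
  obtain ⟨e⟩ := hV
  obtain ⟨f⟩ := hU
  have el : ∀ k v, e.toEquiv (k • v) = k • e.toEquiv v := e.map_left
  have er : ∀ k v, e.toEquiv (op k • v) = op k • e.toEquiv v := e.map_right
  have fl : ∀ k v, f.toEquiv (k • v) = k • f.toEquiv v := f.map_left
  have fr : ∀ k v, f.toEquiv (op k • v) = op k • f.toEquiv v := f.map_right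
  refine equiv_of_bijective
    (comp.desc (fun v u => comp.mk V' U' (e.toEquiv v) (f.toEquiv u)) ?_) ⟨?_, ?_⟩ ?_ ?_
  · intro h v u
    rw [er, fl, comp.op_smul_mk]
  · refine comp.ind fun v u => comp.ind fun v' u' => ?_
    simp only [comp.desc_mk, comp.mk_eq_iff]
    rintro ⟨h, h1, h2⟩
    exact ⟨h, e.toEquiv.injective (by rw [h1, er]), f.toEquiv.injective (by rw [h2, fl])⟩
  · refine comp.ind fun v u => ⟨comp.mk V U (e.toEquiv.symm v) (f.toEquiv.symm u), ?_⟩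
    simp [comp.desc_mk]
  · intro k
    refine comp.ind fun v u => ?_
    simp only [comp.smul_mk, comp.desc_mk, el]
  · intro k
    refine comp.ind fun v u => ?_
    simp only [comp.mk_smul, comp.desc_mk, fr]

theorem comp_assoc (W : FinBiset L K) (V : FinBiset K H) (U : FinBiset H G) :
    comp (comp W V) U ≈ comp W (comp V U) := by
  refine equiv_of_maps
    (comp.desc (comp.desc (fun w v u => comp.mk W _ w (comp.mk V U v u)) ?_) ?_)
    (comp.desc (fun w => comp.desc (fun v u => comp.mk _ U (comp.mk W V w v) u) ?_) ?_) ?_ ?_ ?_ ?_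
  · intro k w v; funext u
    rw [comp.op_smul_mk, comp.smul_mk]
  · intro h; refine comp.ind fun w v => ?_; intro u
    simp only [comp.mk_smul, comp.desc_mk, comp.op_smul_mk]
  · intro h v u
    rw [← comp.mk_smul, comp.op_smul_mk]
  · intro k w; refine comp.ind fun v u => ?_
    simp only [comp.smul_mk, comp.desc_mk, comp.op_smul_mk]
  · refine comp.ind fun x u => ?_
    revert x; refine comp.ind fun w v => rfl
  · refine comp.ind fun w x => ?_
    revert x; refine comp.ind fun w v => rfl
  · intro h; refine comp.ind fun x u => ?_
    revert x; refine comp.ind fun w v => rfl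
  · intro h; refine comp.ind fun x u => ?_
    revert x; refine comp.ind fun w v => rfl

theorem ident_comp [Finite H] (U : FinBiset H G) : comp (ident H) U ≈ U := by
  refine equiv_of_maps (comp.desc (fun (h : H) u => h • u) ?_)
    (fun u => comp.mk (ident H) U (1 : H) u) ?_ ?_ ?_ ?_
  · intro h (v : H) u
    change (v * h) • u = v • h • u
    rw [mul_smul]
  · refine comp.ind fun (v : H) u => ?_
    refine (comp.op_smul_mk (ident H) U v (1 : H) u).symm.trans ?_
    change comp.mk (ident H) U ((1 : H) * v : H) u = _
    rw [one_mul]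
  · intro u; exact one_smul H u
  · intro h; refine comp.ind fun (v : H) u => ?_
    exact mul_smul h v u
  · intro g; refine comp.ind fun (v : H) u => ?_
    exact (smul_comm v (op g) u)

theorem comp_ident [Finite G] (U : FinBiset H G) : comp U (ident G) ≈ U := by
  refine equiv_of_maps (comp.desc (fun u (g : G) => op g • u) ?_)
    (fun u => comp.mk U (ident G) u (1 : G)) ?_ ?_ ?_ ?_
  · intro h u (v : G)
    change op v • op h • u = op (h * v) • u
    rw [op_mul, mul_smul]
  · refine comp.ind fun u (v : G) => ?_
    refine (comp.op_smul_mk U (ident G) v u (1 : G)).trans ?_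
    change comp.mk U (ident G) u (v * (1 : G) : G) = _
    rw [mul_one]
  · intro u; exact one_smul Gᵐᵒᵖ u
  · intro h; refine comp.ind fun u (v : G) => ?_
    exact (smul_comm h (op v) u).symm
  · intro g; refine comp.ind fun u (v : G) => ?_
    exact mul_smul (op g) (op v) u

theorem sum_comp (V V' : FinBiset K H) (U : FinBiset H G) :
    comp (sum V V') U ≈ sum (comp V U) (comp V' U) := by
  refine equiv_of_maps
    (comp.desc (fun (v : V ⊕ V') u => (Sum.elim (fun v => Sum.inl (comp.mk V U v u))
      (fun v => Sum.inr (comp.mk V' U v u)) v : comp V U ⊕ comp V' U)) ?_)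
    (Sum.elim (comp.desc (fun v u => comp.mk (sum V V') U (Sum.inl v : V ⊕ V') u) ?_)
      (comp.desc (fun v u => comp.mk (sum V V') U (Sum.inr v : V ⊕ V') u) ?_)) ?_ ?_ ?_ ?_
  · rintro h (v | v) u
    · exact congrArg Sum.inl (comp.op_smul_mk V U h v u)
    · exact congrArg Sum.inr (comp.op_smul_mk V' U h v u)
  · intro h v u
    exact comp.op_smul_mk (sum V V') U h (Sum.inl v : V ⊕ V') u
  · intro h v u
    exact comp.op_smul_mk (sum V V') U h (Sum.inr v : V ⊕ V') u
  · refine comp.ind ?_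
    rintro (v | v) u <;> rfl
  · rintro (x | x)
    · revert x; exact comp.ind fun v u => rfl
    · revert x; exact comp.ind fun v u => rfl
  · intro k; refine comp.ind ?_
    rintro (v | v) u <;> rfl
  · intro k; refine comp.ind ?_
    rintro (v | v) u <;> rfl

theorem comp_sum (V : FinBiset K H) (U U' : FinBiset H G) :
    comp V (sum U U') ≈ sum (comp V U) (comp V U') := by
  refine equiv_of_maps
    (comp.desc (fun v (u : U ⊕ U') => (Sum.elim (fun u => Sum.inl (comp.mk V U v u))
      (fun u => Sum.inr (comp.mk V U' v u)) u : comp V U ⊕ comp V U')) ?_)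
    (Sum.elim (comp.desc (fun v u => comp.mk V (sum U U') v (Sum.inl u : U ⊕ U')) ?_)
      (comp.desc (fun v u => comp.mk V (sum U U') v (Sum.inr u : U ⊕ U')) ?_)) ?_ ?_ ?_ ?_
  · rintro h v (u | u)
    · exact congrArg Sum.inl (comp.op_smul_mk V U h v u)
    · exact congrArg Sum.inr (comp.op_smul_mk V U' h v u)
  · intro h v u
    exact comp.op_smul_mk V (sum U U') h v (Sum.inl u : U ⊕ U')
  · intro h v u
    exact comp.op_smul_mk V (sum U U') h v (Sum.inr u : U ⊕ U')
  · refine comp.ind ?_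
    rintro v (u | u) <;> rfl
  · rintro (x | x)
    · revert x; exact comp.ind fun v u => rfl
    · revert x; exact comp.ind fun v u => rfl
  · intro k; refine comp.ind ?_
    rintro v (u | u) <;> rfl
  · intro k; refine comp.ind ?_
    rintro v (u | u) <;> rfl

theorem equiv_empty {X : FinBiset H G} (h : X → False) : X ≈ empty H G :=
  equiv_of_bijective (fun x => (h x).elim) ⟨fun x => (h x).elim, fun x => PEmpty.elim x⟩
    (fun _ x => (h x).elim) (fun _ x => (h x).elim)

theorem empty_comp (U : FinBiset H G) : comp (empty K H) U ≈ empty K G :=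
  equiv_empty (comp.ind fun v _ => PEmpty.elim v)

theorem comp_empty (V : FinBiset K H) : comp V (empty H G) ≈ empty K G :=
  equiv_empty (comp.ind fun _ u => PEmpty.elim u)

end Comp

section Prod

variable {H G H' G' : Type u} [Group H] [Group G] [Group H'] [Group G']

/-- The cartesian product of an `(H, G)`-biset and an `(H', G')`-biset, as an
`(H × H', G × G')`-biset. -/
def prod (U : FinBiset H G) (U' : FinBiset H' G') : FinBiset (H × H') (G × G') where
  carrier := U × U'
  left :=
    { smul := fun h x => (h.1 • x.1, h.2 • x.2)
      one_smul := fun x => Prod.ext (one_smul H x.1) (one_smul H' x.2)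
      mul_smul := fun h k x => Prod.ext (mul_smul h.1 k.1 x.1) (mul_smul h.2 k.2 x.2) }
  right :=
    { smul := fun g x => (op g.unop.1 • x.1, op g.unop.2 • x.2)
      one_smul := fun x => Prod.ext (one_smul Gᵐᵒᵖ x.1) (one_smul G'ᵐᵒᵖ x.2)
      mul_smul := fun g k x =>
        Prod.ext (mul_smul (op g.unop.1) (op k.unop.1) x.1)
          (mul_smul (op g.unop.2) (op k.unop.2) x.2) }
  comm := @SMulCommClass.mk _ _ _ (_) (_) fun h g x =>
    Prod.ext (smul_comm h.1 (op g.unop.1) x.1) (smul_comm h.2 (op g.unop.2) x.2)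

theorem prod_congr {U V : FinBiset H G} {U' V' : FinBiset H' G'} (h : U ≈ V) (h' : U' ≈ V') :
    prod U U' ≈ prod V V' := by
  obtain ⟨e⟩ := h
  obtain ⟨f⟩ := h'
  exact ⟨⟨Equiv.prodCongr e.toEquiv f.toEquiv,
    fun h x => Prod.ext (e.map_left h.1 x.1) (f.map_left h.2 x.2),
    fun h x => Prod.ext (e.map_right h.1 x.1) (f.map_right h.2 x.2)⟩⟩

theorem sum_prod (U V : FinBiset H G) (W : FinBiset H' G') :
    prod (sum U V) W ≈ sum (prod U W) (prod V W) :=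
  ⟨⟨Equiv.sumProdDistrib U V W, by rintro h ⟨x | x, y⟩ <;> rfl, by rintro h ⟨x | x, y⟩ <;> rfl⟩⟩

theorem prod_sum (W : FinBiset H G) (U V : FinBiset H' G') :
    prod W (sum U V) ≈ sum (prod W U) (prod W V) :=
  ⟨⟨Equiv.prodSumDistrib W U V, by rintro h ⟨x, y | y⟩ <;> rfl, by rintro h ⟨x, y | y⟩ <;> rfl⟩⟩

theorem empty_prod (W : FinBiset H' G') : prod (empty H G) W ≈ empty (H × H') (G × G') :=
  equiv_empty fun x => PEmpty.elim x.1

theorem prod_empty (W : FinBiset H G) : prod W (empty H' G') ≈ empty (H × H') (G × G') :=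
  equiv_empty fun x => PEmpty.elim x.2

end Prod

/-- The isomorphism classes of finite `(H, G)`-bisets. -/
def Classes (H G : Type u) [Group H] [Group G] : Type (u + 1) :=
  Quotient (isoSetoid H G)

namespace Classes

variable {K H G H' G' : Type u} [Group K] [Group H] [Group G] [Group H'] [Group G']

/-- The isomorphism class of a finite biset. -/
def mk (X : FinBiset H G) : Classes H G := Quotient.mk _ X

theorem sound {X Y : FinBiset H G} (h : X ≈ Y) : mk X = mk Y := Quotient.sound h

/-- Isomorphism classes of bisets form a commutative monoid under disjoint union. -/
instance : Add (Classes H G) where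
  add := Quotient.map₂ sum (by
    rintro X X' ⟨e⟩ Y Y' ⟨f⟩
    refine ⟨⟨Equiv.sumCongr e.toEquiv f.toEquiv, ?_, ?_⟩⟩
    · rintro h (x | x)
      · exact congrArg Sum.inl (e.map_left h x)
      · exact congrArg Sum.inr (f.map_left h x)
    · rintro h (x | x)
      · exact congrArg Sum.inl (e.map_right h x)
      · exact congrArg Sum.inr (f.map_right h x))

instance : Zero (Classes H G) := ⟨mk (empty H G)⟩

instance : AddCommMonoid (Classes H G) where
  nsmul := nsmulRec
  add_assoc := by
    rintro ⟨X⟩ ⟨Y⟩ ⟨Z⟩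
    exact Quotient.sound ⟨⟨Equiv.sumAssoc X Y Z,
      by rintro h ((x | x) | x) <;> rfl, by rintro h ((x | x) | x) <;> rfl⟩⟩
  zero_add := by
    rintro ⟨X⟩
    exact Quotient.sound ⟨⟨Equiv.emptySum PEmpty X,
      by rintro h (x | x); exacts [PEmpty.elim x, rfl],
      by rintro h (x | x); exacts [PEmpty.elim x, rfl]⟩⟩
  add_zero := by
    rintro ⟨X⟩
    exact Quotient.sound ⟨⟨Equiv.sumEmpty X PEmpty,
      by rintro h (x | x); exacts [rfl, PEmpty.elim x],
      by rintro h (x | x); exacts [rfl, PEmpty.elim x]⟩⟩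
  add_comm := by
    rintro ⟨X⟩ ⟨Y⟩
    exact Quotient.sound ⟨⟨Equiv.sumComm X Y,
      by rintro h (x | x) <;> rfl, by rintro h (x | x) <;> rfl⟩⟩

theorem mk_sum (X Y : FinBiset H G) : mk (sum X Y) = mk X + mk Y := rfl

theorem mk_empty : mk (empty H G) = 0 := rfl


/-- Composition of bisets, as a biadditive map on isomorphism classes. -/
def compHom : Classes K H →+ Classes H G →+ Classes K G where
  toFun V :=
    { toFun := fun U => Quotient.map₂ comp (fun _ _ h _ _ h' => comp_congr h h') V U
      map_zero' := by
        obtain ⟨V⟩ := V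
        exact sound (comp_empty V)
      map_add' := by
        obtain ⟨V⟩ := V
        rintro ⟨U⟩ ⟨U'⟩
        exact sound (comp_sum V U U') }
  map_zero' := by
    ext ⟨U⟩
    exact sound (empty_comp U)
  map_add' := by
    rintro ⟨V⟩ ⟨V'⟩
    ext ⟨U⟩
    exact sound (sum_comp V V' U)

theorem compHom_mk (V : FinBiset K H) (U : FinBiset H G) :
    compHom (mk V) (mk U) = mk (comp V U) := rfl

/-- The cartesian product of bisets, as a biadditive map on isomorphism classes. -/
def prodHom : Classes H G →+ Classes H' G' →+ Classes (H × H') (G × G') where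
  toFun V :=
    { toFun := fun U => Quotient.map₂ prod (fun _ _ h _ _ h' => prod_congr h h') V U
      map_zero' := by
        obtain ⟨V⟩ := V
        exact sound (prod_empty V)
      map_add' := by
        obtain ⟨V⟩ := V
        rintro ⟨U⟩ ⟨U'⟩
        exact sound (prod_sum V U U') }
  map_zero' := by
    ext ⟨U⟩
    exact sound (empty_prod U)
  map_add' := by
    rintro ⟨V⟩ ⟨V'⟩
    ext ⟨U⟩
    exact sound (sum_prod V V' U)

theorem prodHom_mk (V : FinBiset H G) (U : FinBiset H' G') :
    prodHom (mk V) (mk U) = mk (prod V U) := rfl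

end Classes

end FinBiset

noncomputable section

/-- `RB(H, G) = R ⊗ B(H, G)`, where `B(H, G)` is the Grothendieck group of the finite
`(H, G)`-bisets with respect to disjoint union. -/
def RB (R : Type v) [CommRing R] (H G : Type u) [Group H] [Group G] : Type (max (u + 1) v) :=
  R ⊗[ℤ] Algebra.GrothendieckAddGroup (FinBiset.Classes H G)

namespace RB

open FinBiset Algebra

variable (R : Type v) [CommRing R]
variable {L K H G H' G' : Type u} [Group L] [Group K] [Group H] [Group G] [Group H'] [Group G']

instance : AddCommGroup (RB R H G) :=
  inferInstanceAs (AddCommGroup (R ⊗[ℤ] GrothendieckAddGroup (Classes H G)))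

instance : Module R (RB R H G) :=
  inferInstanceAs (Module R (R ⊗[ℤ] GrothendieckAddGroup (Classes H G)))

/-- The class in `RB(H, G)` of a finite `(H, G)`-biset. -/
def mk (X : FinBiset H G) : RB R H G :=
  (1 : R) ⊗ₜ[ℤ] GrothendieckAddGroup.of (Classes.mk X)

variable {R}

theorem sound {X Y : FinBiset H G} (h : X ≈ Y) : mk R X = mk R Y := by
  rw [mk, mk, Classes.sound h]

/-- An `R`-linear map on `RB(H, G)` is determined by its values on bisets. -/
theorem hom_ext {M : Type*} [AddCommGroup M] [Module R M] {f g : RB R H G →ₗ[R] M}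
    (h : ∀ X : FinBiset H G, f (mk R X) = g (mk R X)) : f = g := by
  refine TensorProduct.AlgebraTensorModule.curry_injective (LinearMap.ext_ring ?_)
  refine LinearMap.toAddMonoidHom_injective (GrothendieckAddGroup.lift.symm.injective ?_)
  ext ⟨X⟩
  exact h X

/-- The elements of `RB(H, G)` are the linear combinations of bisets. -/
theorem induction_on {p : RB R H G → Prop} (x : RB R H G) (h : ∀ X : FinBiset H G, p (mk R X))
    (zero : p 0) (add : ∀ x y, p x → p y → p (x + y)) (smul : ∀ (r : R) x, p x → p (r • x)) :
    p x := by
  have key : Submodule.span R (Set.range (mk R (H := H) (G := G))) = ⊤ := by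
    rw [← Submodule.ker_mkQ (Submodule.span R _), LinearMap.ker_eq_top]
    refine hom_ext fun X => ?_
    rw [LinearMap.zero_apply, Submodule.mkQ_apply, Submodule.Quotient.mk_eq_zero]
    exact Submodule.subset_span ⟨X, rfl⟩
  have hx : x ∈ Submodule.span R (Set.range (mk R (H := H) (G := G))) := key ▸ Submodule.mem_top
  induction hx using Submodule.span_induction with
  | mem x hx => obtain ⟨X, rfl⟩ := hx; exact h X
  | zero => exact zero
  | add x y _ _ hx hy => exact add x y hx hy
  | smul r x _ hx => exact smul r x hx

/-- The biadditive extension to Grothendieck groups of a biadditive map. -/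
def extendGroup {M N P : Type*} [AddCommMonoid M] [AddCommMonoid N] [AddCommMonoid P]
    (f : M →+ N →+ P) :
    GrothendieckAddGroup M →+ GrothendieckAddGroup N →+ GrothendieckAddGroup P :=
  (GrothendieckAddGroup.lift (GrothendieckAddGroup.lift
    ((AddMonoidHom.compHom GrothendieckAddGroup.of).comp f)).flip).flip

theorem lift_of {M A : Type*} [AddCommMonoid M] [AddCommGroup A] (f : M →+ A) (m : M) :
    GrothendieckAddGroup.lift f (GrothendieckAddGroup.of m) = f m :=
  DFunLike.congr_fun (GrothendieckAddGroup.lift.symm_apply_apply f) m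

theorem extendGroup_of {M N P : Type*} [AddCommMonoid M] [AddCommMonoid N] [AddCommMonoid P]
    (f : M →+ N →+ P) (m : M) (n : N) :
    extendGroup f (GrothendieckAddGroup.of m) (GrothendieckAddGroup.of n) =
      GrothendieckAddGroup.of (f m n) := by
  rw [extendGroup, AddMonoidHom.flip_apply, lift_of, AddMonoidHom.flip_apply, lift_of]
  rfl

/-- The bilinear extension of scalars of a biadditive map. -/
def extendScalars (R : Type v) [CommRing R] {A B C : Type*} [AddCommGroup A] [AddCommGroup B]
    [AddCommGroup C] (f : A →+ B →+ C) : R ⊗[ℤ] A →ₗ[R] R ⊗[ℤ] B →ₗ[R] R ⊗[ℤ] C :=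
  LinearMap.liftBaseChange R (AddMonoidHom.toIntLinearMap
    { toFun := fun x => LinearMap.baseChange R (f x).toIntLinearMap
      map_zero' := by ext; simp
      map_add' := fun x y => by ext; simp [TensorProduct.tmul_add] })

theorem extendScalars_tmul {A B C : Type*} [AddCommGroup A] [AddCommGroup B]
    [AddCommGroup C] (f : A →+ B →+ C) (a : A) (b : B) :
    extendScalars R f (1 ⊗ₜ a) (1 ⊗ₜ b) = 1 ⊗ₜ f a b := by
  simp [extendScalars]

/-- The bilinear extension to `RB` of a biadditive map on isomorphism classes of bisets. -/
def extend {H₁ G₁ H₂ G₂ H₃ G₃ : Type u} [Group H₁] [Group G₁] [Group H₂] [Group G₂] [Group H₃]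
    [Group G₃] (f : Classes H₁ G₁ →+ Classes H₂ G₂ →+ Classes H₃ G₃) :
    RB R H₁ G₁ →ₗ[R] RB R H₂ G₂ →ₗ[R] RB R H₃ G₃ :=
  extendScalars R (extendGroup f)

theorem extend_mk {H₁ G₁ H₂ G₂ H₃ G₃ : Type u} [Group H₁] [Group G₁] [Group H₂] [Group G₂]
    [Group H₃] [Group G₃] (f : Classes H₁ G₁ →+ Classes H₂ G₂ →+ Classes H₃ G₃)
    (X : FinBiset H₁ G₁) (Y : FinBiset H₂ G₂) (Z : FinBiset H₃ G₃)
    (h : f (Classes.mk X) (Classes.mk Y) = Classes.mk Z) :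
    extend f (mk R X) (mk R Y) = mk R Z :=
  (extendScalars_tmul _ _ _).trans (by rw [extendGroup_of, h]; rfl)

/-- The composition `RB(K, H) × RB(H, G) → RB(K, G)`, the bilinear extension of `(V, U) ↦ V ×_H U`. -/
def comp : RB R K H →ₗ[R] RB R H G →ₗ[R] RB R K G := extend Classes.compHom

theorem comp_mk (V : FinBiset K H) (U : FinBiset H G) :
    comp (mk R V) (mk R U) = mk R (V.comp U) := extend_mk _ _ _ _ rfl

/-- The product `RB(H, G) × RB(H', G') → RB(H × H', G × G')`, the bilinear extension of the
cartesian product of bisets. -/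
def prod : RB R H G →ₗ[R] RB R H' G' →ₗ[R] RB R (H × H') (G × G') := extend Classes.prodHom

theorem prod_mk (V : FinBiset H G) (U : FinBiset H' G') :
    prod (mk R V) (mk R U) = mk R (V.prod U) := extend_mk _ _ _ _ rfl

theorem comp_assoc (γ : RB R L K) (β : RB R K H) (α : RB R H G) :
    comp (comp γ β) α = comp γ (comp β α) := by
  induction γ using induction_on with
  | zero => simp
  | add x y hx hy => simp [hx, hy]
  | smul r x hx => simp [hx]
  | h W =>
    induction β using induction_on with
    | zero => simp
    | add x y hx hy => simp [hx, hy]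
    | smul r x hx => simp [hx]
    | h V =>
      induction α using induction_on with
      | zero => simp
      | add x y hx hy => simp [hx, hy]
      | smul r x hx => simp [hx]
      | h U =>
        simp only [comp_mk]
        exact sound (FinBiset.comp_assoc W V U)

theorem ident_comp [Finite H] (α : RB R H G) : comp (mk R (ident H)) α = α :=
  LinearMap.congr_fun (f := comp (mk R (ident H))) (g := LinearMap.id)
    (hom_ext fun X => (comp_mk _ _).trans (sound (FinBiset.ident_comp X))) α

theorem comp_ident [Finite G] (α : RB R H G) : comp α (mk R (ident G)) = α :=
  LinearMap.congr_fun (f := comp.flip (mk R (ident G))) (g := LinearMap.id)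
    (hom_ext fun X => (comp_mk _ _).trans (sound (FinBiset.comp_ident X))) α

end RB

/-- A non-empty class of finite groups which is closed under subquotients (it contains every
finite group that is a homomorphic image of a subgroup of one of its members) and under direct
products. In particular it is closed under isomorphisms. -/
structure GroupClass where
  Mem : ∀ (G : Type u) [Group G] [Finite G], Prop
  nonempty : ∃ (G : Type u) (_ : Group G) (_ : Finite G), Mem G
  subquotient : ∀ (G K : Type u) [Group G] [Finite G] [Group K] [Finite K] (S : Subgroup G)
    (f : S →* K), Function.Surjective f → Mem G → Mem K
  prod : ∀ (G H : Type u) [Group G] [Finite G] [Group H] [Finite H],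
    Mem G → Mem H → Mem (G × H)

theorem GroupClass.one_mem (Z : GroupClass.{u}) : Z.Mem PUnit.{u + 1} := by
  obtain ⟨G, _, _, hG⟩ := Z.nonempty
  exact Z.subquotient G PUnit ⊥ 1 (fun _ => ⟨1, rfl⟩) hG

/-- The objects of the biset category `Ω_{R, Z}`: the groups of the class `Z`. -/
structure BisetCat (R : Type v) [CommRing R] (Z : GroupClass.{u}) where
  carrier : Type u
  [group : Group carrier]
  [finite : Finite carrier]
  mem : Z.Mem carrier

namespace BisetCat

variable {R : Type v} [CommRing R] {Z : GroupClass.{u}}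

instance : CoeSort (BisetCat R Z) (Type u) := ⟨carrier⟩

attribute [instance] group finite

/-- The biset category: `Hom(G, H) = RB(H, G)`, the composite of `α ∈ RB(H, G)` and
`β ∈ RB(K, H)` is `β ×_H α`, and the identity of `G` is the class of the `(G, G)`-biset `G`. -/
instance : Category.{max (u + 1) v} (BisetCat R Z) where
  Hom G H := RB R H G
  id G := RB.mk R (FinBiset.ident G)
  comp α β := RB.comp β α
  id_comp α := RB.comp_ident α
  comp_id α := RB.ident_comp α
  assoc α β γ := (RB.comp_assoc γ β α).symm

instance : Preadditive (BisetCat R Z) where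
  homGroup G H := inferInstanceAs (AddCommGroup (RB R H G))
  add_comp G H K α α' β := LinearMap.map_add (RB.comp (R := R) (K := K) (H := H) (G := G) β) α α'
  comp_add G H K α β β' := LinearMap.map_add₂ (RB.comp (R := R) (K := K) (H := H) (G := G)) β β' α

instance : Linear R (BisetCat R Z) where
  homModule G H := inferInstanceAs (Module R (RB R H G))
  smul_comp G H K r α β := LinearMap.map_smul (RB.comp (R := R) (K := K) (H := H) (G := G) β) r α
  comp_smul G H K α r β := LinearMap.map_smul₂ (RB.comp (R := R) (K := K) (H := H) (G := G)) r β α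

/-- The trivial group. -/
abbrev one (R : Type v) [CommRing R] (Z : GroupClass.{u}) : BisetCat R Z :=
  { carrier := PUnit, mem := Z.one_mem }

/-- The direct product of two groups of the class. -/
abbrev prod (G H : BisetCat R Z) : BisetCat R Z :=
  { carrier := G × H, mem := Z.prod G H G.mem H.mem }

/-- The morphism `G ⟶ H` given by a finite `(H, G)`-biset. -/
def ofBiset {G H : BisetCat R Z} (X : FinBiset H G) : G ⟶ H := RB.mk R X

/-- The morphism `φ × ψ` for `φ ∈ RB(G', G)` and `ψ ∈ RB(H', H)`. -/
def prodMap {G G' H H' : BisetCat R Z} (φ : G ⟶ G') (ψ : H ⟶ H') : prod G H ⟶ prod G' H' :=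
  RB.prod (φ : RB R G' G) (ψ : RB R H' H)

/-- The morphism `Iso(f)` given by a group isomorphism `f : G → H`. -/
def isoMap {G H : BisetCat R Z} (f : G ≃* H) : G ⟶ H := ofBiset (FinBiset.iso f)

end BisetCat

/-- The data of a Green biset functor on `Ω_{R, Z}`, without its axioms: the effect on objects and
morphisms, the bilinear products `A(G) × A(H) → A(G × H)`, and an element of `A(1)`. -/
structure GreenBisetData (R : Type v) [CommRing R] (Z : GroupClass.{u}) extends
    Prefunctor (BisetCat R Z) (ModuleCat.{w} R) where
  mul : ∀ G H : BisetCat R Z, obj G →ₗ[R] obj H →ₗ[R] obj (G.prod H)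
  one : obj (BisetCat.one R Z)

/-- `F` is a biset functor: an `R`-linear functor from `Ω_{R, Z}` to `R`-modules. -/
structure IsBisetFunctor {R : Type v} [CommRing R] {Z : GroupClass.{u}}
    (F : Prefunctor (BisetCat R Z) (ModuleCat.{w} R)) : Prop where
  map_id : ∀ G, F.map (𝟙 G) = 𝟙 (F.obj G)
  map_comp : ∀ {G H K : BisetCat R Z} (α : G ⟶ H) (β : H ⟶ K),
    F.map (α ≫ β) = F.map α ≫ F.map β
  map_add : ∀ {G H : BisetCat R Z} (α β : G ⟶ H), F.map (α + β) = F.map α + F.map β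
  map_smul : ∀ {G H : BisetCat R Z} (r : R) (α : G ⟶ H), F.map (r • α) = r • F.map α

namespace GreenBisetData

variable {R : Type v} [CommRing R] {Z : GroupClass.{u}}

/-- The axioms of a Green biset functor. -/
structure IsGreenBisetFunctor (A : GreenBisetData.{u, v, w} R Z) : Prop where
  isBisetFunctor : IsBisetFunctor A.toPrefunctor
  /-- `(a × b) × c = A(Iso(α)) (a × (b × c))` for `α : G × (H × K) ≃ (G × H) × K`. -/
  mul_assoc : ∀ (G H K : BisetCat R Z) (a : A.obj G) (b : A.obj H) (c : A.obj K),
    A.mul (G.prod H) K (A.mul G H a b) c =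
      A.map (BisetCat.isoMap (G := G.prod (H.prod K)) (H := (G.prod H).prod K)
        (MulEquiv.prodAssoc (M := G) (N := H) (P := K)).symm)
        (A.mul G (H.prod K) a (A.mul H K b c))
  /-- `a = A(Iso(λ)) (ε × a)` for `λ : 1 × G ≃ G`. -/
  one_mul : ∀ (G : BisetCat R Z) (a : A.obj G),
    A.map (BisetCat.isoMap (G := (BisetCat.one R Z).prod G) (H := G) MulEquiv.uniqueProd)
      (A.mul (BisetCat.one R Z) G A.one a) = a
  /-- `a = A(Iso(ρ)) (a × ε)` for `ρ : G × 1 ≃ G`. -/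
  mul_one : ∀ (G : BisetCat R Z) (a : A.obj G),
    A.map (BisetCat.isoMap (G := G.prod (BisetCat.one R Z)) (H := G) MulEquiv.prodUnique)
      (A.mul G (BisetCat.one R Z) a A.one) = a
  /-- `A(φ × ψ) (a × b) = A(φ)(a) × A(ψ)(b)`. -/
  map_mul : ∀ {G G' H H' : BisetCat R Z} (φ : G ⟶ G') (ψ : H ⟶ H') (a : A.obj G) (b : A.obj H),
    A.map (BisetCat.prodMap φ ψ) (A.mul G H a b) = A.mul G' H' (A.map φ a) (A.map ψ b)

end GreenBisetData

namespace YonedaDress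

/-- The subgroup `D = {(c, g, c)}` of `C × G × C`. -/
def diag (G C : Type u) [Group G] [Group C] : Subgroup (C × (G × C)) where
  carrier := {x | x.1 = x.2.2}
  mul_mem' := by
    rintro x y (hx : x.1 = x.2.2) (hy : y.1 = y.2.2)
    change x.1 * y.1 = x.2.2 * y.2.2
    rw [hx, hy]
  one_mem' := rfl
  inv_mem' := by
    rintro x (hx : x.1 = x.2.2)
    change x.1⁻¹ = x.2.2⁻¹
    rw [hx]

/-- The isomorphism `f : D → G × C`, `(c, g, c) ↦ (g, c)`. -/
def diagEquiv (G C : Type u) [Group G] [Group C] : diag G C ≃* G × C where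
  toFun x := x.1.2
  invFun y := ⟨(y.2, y), rfl⟩
  left_inv := by
    rintro ⟨⟨c, y⟩, h⟩
    exact Subtype.ext (Prod.ext (Eq.symm h) rfl)
  right_inv _ := rfl
  map_mul' _ _ := rfl

/-- The `(G × C, C × G × C)`-biset `X_C^G = Iso(f) ×_D Res_D^{C × G × C}`. -/
def diagBiset (G C : Type u) [Group G] [Group C] [Finite G] [Finite C] :
    FinBiset (G × C) (C × (G × C)) :=
  (FinBiset.iso (diagEquiv G C)).comp (FinBiset.res (diag G C))

variable {R : Type v} [CommRing R] {Z : GroupClass.{u}}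

/-- The morphism `K × X_C^G` from `(K × C) × (G × C)` to `(K × G) × C`, after the canonical
identifications `(K × C) × (G × C) = K × (C × (G × C))` and `K × (G × C) = (K × G) × C`. -/
def mulMap (K G C : BisetCat R Z) : (K.prod C).prod (G.prod C) ⟶ (K.prod G).prod C :=
  BisetCat.isoMap (G := (K.prod C).prod (G.prod C)) (H := K.prod (C.prod (G.prod C)))
      (MulEquiv.prodAssoc (M := K) (N := C) (P := G × C)) ≫
    BisetCat.prodMap (𝟙 K)
      (BisetCat.ofBiset (G := C.prod (G.prod C)) (H := G.prod C) (diagBiset G C)) ≫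
    BisetCat.isoMap (G := K.prod (G.prod C)) (H := (K.prod G).prod C)
      (MulEquiv.prodAssoc (M := K) (N := G) (P := C)).symm

/-- The inflation `Inf_1^{1 × C}` along the projection `1 × C → 1`. -/
def oneMap (C : BisetCat R Z) : BisetCat.one R Z ⟶ (BisetCat.one R Z).prod C :=
  BisetCat.ofBiset (G := BisetCat.one R Z) (H := (BisetCat.one R Z).prod C)
    (FinBiset.inf (MonoidHom.fst PUnit C) Prod.fst_surjective)

end YonedaDress

/-- The Yoneda–Dress construction `A_C` at `C`: `A_C(G) = A(G × C)` and `A_C(φ) = A(φ × C)`, with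
the products `A_C(K) × A_C(G) → A((K × C) × (G × C)) → A((K × G) × C) = A_C(K × G)`, the product of
`A` followed by `A(K × X_C^G)`, and the element `A(Inf_1^{1 × C})(ε_A)` of `A_C(1)`. -/
def GreenBisetData.yonedaDress {R : Type v} [CommRing R] {Z : GroupClass.{u}}
    (A : GreenBisetData.{u, v, w} R Z) (C : BisetCat R Z) : GreenBisetData.{u, v, w} R Z where
  obj G := A.obj (G.prod C)
  map φ := A.map (BisetCat.prodMap φ (𝟙 C))
  mul K G := (A.mul (K.prod C) (G.prod C)).compr₂ (A.map (YonedaDress.mulMap K G C)).hom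
  one := A.map (YonedaDress.oneMap C) A.one

end

/-! Every structural morphism in the statement is a restriction along a group homomorphism. For $a :
G \to H$, the set $H$ with $G$ acting on the left through $a$ is a $(G,H)$-biset, written `resMap
a`; this is contravariantly functorial in $a$ and compatible with products. $\mathrm{Iso}(f)$ is
restriction along $f^{-1}$, $\mathrm{Inf}_1^{1\times C}$ is restriction along the projection
$1\times C\to 1$, and $K\times X_C^G$, with its rebracketings, is restriction along the diagonal
$((k,g),c)\mapsto((k,c),(g,c))$ (`mulMap_eq_resMap`).

The associativity and unit axioms of $A_C$ therefore follow from those of $A$, once the maps applied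
to the factors are moved outside the products (`mul_map_left`, `mul_map_right`). What remains is an
equality of two group homomorphisms, expressing that the diagonal of $C$ is coassociative and that
the projection to $1$ is its counit; both hold by computation.

The compatibility of products with morphisms is the one axiom that involves arbitrary bisets. It
needs the diagonal to be natural: restricting $(U\times C)\times(V\times C)$ along it on the left
agrees with composing $(U\times V)\times C$ with it on the right (`prod_comp_diag`). This is checked
on bisets and extended by linearity (`mulMap_comp_prodMap`). Functoriality of $A_C$ comes from the
interchange law for $\times$ and composition (`prodMap_comp`). -/

namespace FinBiset

/-! ### Restriction bisets along homomorphisms. -/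

section Restriction

variable {K H G H' G' : Type u} [Group K] [Group H] [Group G] [Group H'] [Group G']

/-- The `(K, G)`-biset obtained from an `(H, G)`-biset by restriction along `a : K → H`. -/
def restrict (a : K →* H) (X : FinBiset H G) : FinBiset K G where
  carrier := X
  left := MulAction.compHom X a
  comm := @SMulCommClass.mk _ _ _ (_) (_) fun k g (x : X) => smul_comm (a k) g x

/-- Every orbit $[v,x]$ in $H\times_H X$ contains exactly one pair with first coordinate $1$, namely
$(1, v\cdot x)$; on these representatives $K$ acts through $a$. -/
theorem ofHoms_comp [Finite H] (a : K →* H) (X : FinBiset H G) :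
    comp (ofHoms a (MonoidHom.id H)) X ≈ restrict a X := by
  refine equiv_of_maps (X := comp (ofHoms a (MonoidHom.id H)) X) (Y := restrict a X)
    (comp.desc (T := X) (fun (h : H) (x : X) => h • x) ?_)
    (fun (x : X) => comp.mk (ofHoms a (MonoidHom.id H)) X (1 : H) x) ?_ ?_ ?_ ?_
  · intro h (v : H) x
    exact mul_smul v h x
  · refine comp.ind fun (v : H) x => ?_
    refine (comp.op_smul_mk (ofHoms a (MonoidHom.id H)) X v (1 : H) x).symm.trans ?_
    exact congrArg (comp.mk (ofHoms a (MonoidHom.id H)) X · x) (one_mul v)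
  · intro (x : X); exact one_smul H x
  · intro k; refine comp.ind fun (v : H) x => ?_
    exact mul_smul (a k) v x
  · intro g; refine comp.ind fun (v : H) x => ?_
    exact smul_comm v (op g) x

theorem ofHoms_comp_ofHoms [Finite H] [Finite G] (a : K →* H) (b : H →* G) :
    comp (ofHoms a (MonoidHom.id H)) (ofHoms b (MonoidHom.id G)) ≈
      ofHoms (b.comp a) (MonoidHom.id G) :=
  ofHoms_comp a _

/-- Transporting the set $H$ along $f^{-1}$ moves the twist by $f$ on the right to a twist by
$f^{-1}$ on the left, so that isomorphisms too become restrictions. -/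
theorem iso_equiv [Finite H] [Finite G] (f : G ≃* H) :
    iso f ≈ ofHoms f.symm.toMonoidHom (MonoidHom.id G) := by
  refine ⟨⟨f.symm.toEquiv, fun h (x : H) => ?_, fun g (x : H) => ?_⟩⟩
  · exact map_mul f.symm h x
  · change f.symm (x * f g) = f.symm x * g
    simp

theorem ofHoms_prod [Finite G] [Finite G'] (a : H →* G) (b : H' →* G') :
    prod (ofHoms a (MonoidHom.id G)) (ofHoms b (MonoidHom.id G')) ≈
      ofHoms (a.prodMap b) (MonoidHom.id (G × G')) :=
  ⟨⟨Equiv.refl _, fun _ _ => rfl, fun _ _ => rfl⟩⟩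

end Restriction

/-! ### Interchange of composition and cartesian product. -/

section Interchange

variable {K H G K' H' G' : Type u} [Group K] [Group H] [Group G] [Group K'] [Group H'] [Group G']

/-- The group $H\times H'$ acts coordinatewise, so its orbits are products of orbits: elements of
$H$ and $H'$ identifying the two coordinates separately combine into one element of $H\times H'$. -/
theorem prod_comp_prod (V : FinBiset K H) (U : FinBiset H G) (V' : FinBiset K' H')
    (U' : FinBiset H' G') :
    comp (prod V V') (prod U U') ≈ prod (comp V U) (comp V' U') := by
  refine equiv_of_bijective (X := comp (prod V V') (prod U U'))
    (Y := prod (comp V U) (comp V' U'))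
    (comp.desc (T := comp V U × comp V' U')
      (fun (v : V × V') (u : U × U') => (comp.mk V U v.1 u.1, comp.mk V' U' v.2 u.2)) ?_)
    ⟨?_, ?_⟩ ?_ ?_
  · intro h v u
    exact Prod.ext (comp.op_smul_mk V U h.1 v.1 u.1) (comp.op_smul_mk V' U' h.2 v.2 u.2)
  · refine comp.ind fun v u => comp.ind fun v' u' e => ?_
    obtain ⟨h, h1, h2⟩ := comp.mk_eq_iff.1 (congrArg Prod.fst e)
    obtain ⟨h', h1', h2'⟩ := comp.mk_eq_iff.1 (congrArg Prod.snd e)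
    exact comp.mk_eq_iff.2 ⟨(h, h'), Prod.ext h1 h1', Prod.ext h2 h2'⟩
  · rintro ⟨x, x'⟩
    revert x; refine comp.ind fun v u => ?_
    revert x'; refine comp.ind fun v' u' => ?_
    exact ⟨comp.mk (prod V V') (prod U U') (v, v') (u, u'), rfl⟩
  · intro k; refine comp.ind fun v u => rfl
  · intro k; refine comp.ind fun v u => rfl

end Interchange

end FinBiset

/-! ### The diagonal of $C$ and its naturality on bisets. -/

namespace YonedaDress

/-- The homomorphism `(k, g, c) ↦ (k, c, g, c)`. -/
def diagHom (K G C : Type u) [Group K] [Group G] [Group C] :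
    (K × G) × C →* (K × C) × (G × C) where
  toFun x := ((x.1.1, x.2), (x.1.2, x.2))
  map_one' := rfl
  map_mul' _ _ := rfl

-- Both sides are the set $(U\times C)\times(V\times C)$ with $(K'\times G')\times C$ acting through
-- the diagonal. On the left side, $[((x,y),d),((k,c),(g,c'))]$ corresponds to $((xk,dc),(yg,dc'))$:
-- the $U$ and $V$ coordinates absorb $k$ and $g$, while the single $d\in C$ is spread over both
-- copies of $C$.
open FinBiset in
theorem prod_comp_diag {K G K' G' : Type u} (C : Type u) [Group K] [Group G] [Group K'] [Group G']
    [Group C] [Finite K] [Finite G] [Finite K'] [Finite G'] [Finite C]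
    (U : FinBiset K' K) (V : FinBiset G' G) :
    comp (prod (prod U V) (ident C)) (ofHoms (diagHom K G C) (MonoidHom.id _)) ≈
      comp (ofHoms (diagHom K' G' C) (MonoidHom.id _))
        (prod (prod U (ident C)) (prod V (ident C))) := by
  refine Setoid.trans ?_ (Setoid.symm (ofHoms_comp _ _))
  refine equiv_of_maps
    (X := comp (prod (prod U V) (ident C)) (ofHoms (diagHom K G C) (MonoidHom.id _)))
    (Y := restrict (diagHom K' G' C) (prod (prod U (ident C)) (prod V (ident C))))
    (comp.desc (T := (U × C) × (V × C)) (fun (x : (U × V) × C) (y : (K × C) × (G × C)) =>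
      ((op y.1.1 • x.1.1, x.2 * y.1.2), (op y.2.1 • x.1.2, x.2 * y.2.2))) ?_)
    (fun (z : (U × C) × (V × C)) => comp.mk (prod (prod U V) (ident C))
      (ofHoms (diagHom K G C) (MonoidHom.id _)) ((z.1.1, z.2.1), (1 : C))
      ((((1 : K), z.1.2), ((1 : G), z.2.2)) : (K × C) × (G × C))) ?_ ?_ ?_ ?_
  · rintro ⟨⟨k, g⟩, c⟩ ⟨⟨x, y⟩, (d : C)⟩ ⟨⟨k', (c' : C)⟩, ⟨g', (d' : C)⟩⟩
    change ((op k' • op k • x, d * c * c'), (op g' • op g • y, d * c * d')) =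
      ((op (k * k') • x, d * (c * c')), (op (g * g') • y, d * (c * d')))
    simp only [op_mul, mul_smul, mul_assoc]
  · refine comp.ind ?_
    rintro ⟨⟨x, y⟩, (d : C)⟩ ⟨⟨k, (c : C)⟩, ⟨g, (c' : C)⟩⟩
    -- The normalized representative is $(((xk,yg),1),((1,dc),(1,dc')))$. Acting by $k^{-1}$ and
    -- $g^{-1}$ undoes the absorption, and acting by $d$ turns the coordinate $1$ back into $d$.
    refine comp.mk_eq_iff.2 ⟨((k⁻¹, g⁻¹), d), Prod.ext (Prod.ext ?_ ?_) ?_,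
      Prod.ext (Prod.ext ?_ ?_) (Prod.ext ?_ ?_)⟩
    · exact (inv_smul_smul (op k) x).symm
    · exact (inv_smul_smul (op g) y).symm
    · exact (one_mul d).symm
    · exact show k = k⁻¹⁻¹ * 1 by simp
    · exact show c = d⁻¹ * (d * c) by simp
    · exact show g = g⁻¹⁻¹ * 1 by simp
    · exact show c' = d⁻¹ * (d * c') by simp
  · rintro ⟨⟨x, (c : C)⟩, ⟨y, (d : C)⟩⟩
    exact Prod.ext (Prod.ext (one_smul Kᵐᵒᵖ x) (one_mul c))
      (Prod.ext (one_smul Gᵐᵒᵖ y) (one_mul d))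
  · rintro ⟨⟨k, g⟩, c⟩
    refine comp.ind ?_
    rintro ⟨⟨x, y⟩, (d : C)⟩ ⟨⟨k', (c' : C)⟩, ⟨g', (d' : C)⟩⟩
    exact Prod.ext (Prod.ext (smul_comm k (op k') x).symm (mul_assoc c d c'))
      (Prod.ext (smul_comm g (op g') y).symm (mul_assoc c d d'))
  · rintro ⟨⟨k, (c : C)⟩, ⟨g, (c₁ : C)⟩⟩
    refine comp.ind ?_
    rintro ⟨⟨x, y⟩, (d : C)⟩ ⟨⟨k', (c' : C)⟩, ⟨g', (d' : C)⟩⟩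
    exact Prod.ext (Prod.ext (mul_smul (op k) (op k') x) (mul_assoc d c' c).symm)
      (Prod.ext (mul_smul (op g) (op g') y) (mul_assoc d d' c₁).symm)

open FinBiset in
theorem diagBiset_equiv (G C : Type u) [Group G] [Group C] [Finite G] [Finite C] :
    diagBiset G C ≈ ofHoms ((diag G C).subtype.comp (diagEquiv G C).symm.toMonoidHom)
      (MonoidHom.id _) :=
  Setoid.trans (comp_congr (iso_equiv _) (Setoid.refl _)) (ofHoms_comp_ofHoms _ _)

end YonedaDress

/-! ### Restriction morphisms and bifunctoriality of the product in the biset category. -/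

namespace BisetCat

variable {R : Type v} [CommRing R] {Z : GroupClass.{u}}

/-- The morphism `H ⟶ G` given by restriction along a homomorphism `G → H`. -/
noncomputable def resMap {G H : BisetCat R Z} (a : G →* H) : H ⟶ G :=
  ofBiset (FinBiset.ofHoms a (MonoidHom.id H))

theorem ofBiset_comp {G H K : BisetCat R Z} (U : FinBiset H G) (V : FinBiset K H) :
    (ofBiset U : G ⟶ H) ≫ (ofBiset V : H ⟶ K) = ofBiset (V.comp U) :=
  RB.comp_mk V U

theorem ofBiset_congr {G H : BisetCat R Z} {X Y : FinBiset H G} (h : X ≈ Y) :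
    (ofBiset X : G ⟶ H) = ofBiset Y :=
  RB.sound h

theorem prodMap_ofBiset {G G' H H' : BisetCat R Z} (U : FinBiset G' G) (V : FinBiset H' H) :
    prodMap (ofBiset U : G ⟶ G') (ofBiset V : H ⟶ H') = ofBiset (U.prod V) :=
  RB.prod_mk U V

/-- Morphisms are linear combinations of bisets. -/
theorem hom_induction {G H : BisetCat R Z} {p : (G ⟶ H) → Prop} (φ : G ⟶ H)
    (h : ∀ X : FinBiset H G, p (ofBiset X)) (zero : p 0)
    (add : ∀ φ ψ, p φ → p ψ → p (φ + ψ)) (smul : ∀ (r : R) φ, p φ → p (r • φ)) : p φ :=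
  RB.induction_on φ h zero add smul

section Linear

variable {G G' H H' : BisetCat R Z}

@[simp] theorem prodMap_zero (φ : G ⟶ G') : prodMap φ (0 : H ⟶ H') = 0 :=
  LinearMap.map_zero (RB.prod (φ : RB R G' G))

@[simp] theorem zero_prodMap (ψ : H ⟶ H') : prodMap (0 : G ⟶ G') ψ = 0 :=
  LinearMap.map_zero₂ RB.prod (ψ : RB R H' H)

@[simp] theorem prodMap_add (φ : G ⟶ G') (ψ ψ' : H ⟶ H') :
    prodMap φ (ψ + ψ') = prodMap φ ψ + prodMap φ ψ' :=
  LinearMap.map_add (RB.prod (φ : RB R G' G)) ψ ψ'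

@[simp] theorem add_prodMap (φ φ' : G ⟶ G') (ψ : H ⟶ H') :
    prodMap (φ + φ') ψ = prodMap φ ψ + prodMap φ' ψ :=
  LinearMap.map_add₂ RB.prod (φ : RB R G' G) φ' (ψ : RB R H' H)

@[simp] theorem prodMap_smul (r : R) (φ : G ⟶ G') (ψ : H ⟶ H') :
    prodMap φ (r • ψ) = r • prodMap φ ψ :=
  LinearMap.map_smul (RB.prod (φ : RB R G' G)) r ψ

@[simp] theorem smul_prodMap (r : R) (φ : G ⟶ G') (ψ : H ⟶ H') :
    prodMap (r • φ) ψ = r • prodMap φ ψ :=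
  LinearMap.map_smul₂ RB.prod r (φ : RB R G' G) (ψ : RB R H' H)

end Linear

/-- Both sides are linear in each of the four morphisms, which reduces the claim to bisets and hence
to `FinBiset.prod_comp_prod`. -/
theorem prodMap_comp {G H K G' H' K' : BisetCat R Z} (α : G ⟶ H) (β : H ⟶ K) (α' : G' ⟶ H')
    (β' : H' ⟶ K') : prodMap (α ≫ β) (α' ≫ β') = prodMap α α' ≫ prodMap β β' := by
  induction α using hom_induction with
  | zero => simp
  | add x y hx hy => simp [hx, hy]
  | smul r x hx => simp [hx]
  | h U =>
    induction β using hom_induction with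
    | zero => simp
    | add x y hx hy => simp [hx, hy]
    | smul r x hx => simp [hx]
    | h V =>
      induction α' using hom_induction with
      | zero => simp
      | add x y hx hy => simp [hx, hy]
      | smul r x hx => simp [hx]
      | h U' =>
        induction β' using hom_induction with
        | zero => simp
        | add x y hx hy => simp [hx, hy]
        | smul r x hx => simp [hx]
        | h V' =>
          simp only [ofBiset_comp, prodMap_ofBiset]
          exact ofBiset_congr (Setoid.symm (FinBiset.prod_comp_prod V U V' U'))

theorem resMap_comp {G H K : BisetCat R Z} (a : H →* G) (b : K →* H) :
    resMap a ≫ resMap b = resMap (a.comp b) :=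
  (ofBiset_comp _ _).trans (ofBiset_congr (FinBiset.ofHoms_comp_ofHoms b a))

theorem prodMap_resMap {G G' H H' : BisetCat R Z} (a : G' →* G) (b : H' →* H) :
    prodMap (resMap a) (resMap b) =
      resMap (G := G'.prod H') (H := G.prod H) (a.prodMap b) :=
  (prodMap_ofBiset _ _).trans (ofBiset_congr (FinBiset.ofHoms_prod a b))

/-- By definition, the identity of $H$ in the biset category is restriction along the identity
homomorphism. -/
theorem prodMap_resMap_id {G G' H : BisetCat R Z} (a : G' →* G) :
    prodMap (resMap a) (𝟙 H) =
      resMap (G := G'.prod H) (H := G.prod H) (a.prodMap (MonoidHom.id H)) :=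
  prodMap_resMap a (MonoidHom.id H)

theorem prodMap_id_resMap {G H H' : BisetCat R Z} (b : H' →* H) :
    prodMap (𝟙 G) (resMap b) =
      resMap (G := G.prod H') (H := G.prod H) ((MonoidHom.id G).prodMap b) :=
  prodMap_resMap (MonoidHom.id G) b

theorem prodMap_id (G H : BisetCat R Z) : prodMap (𝟙 G) (𝟙 H) = 𝟙 (G.prod H) :=
  prodMap_resMap (MonoidHom.id G) (MonoidHom.id H)

theorem isoMap_eq_resMap {G H : BisetCat R Z} (f : G ≃* H) :
    isoMap f = resMap f.symm.toMonoidHom :=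
  ofBiset_congr (FinBiset.iso_equiv f)

end BisetCat

/-! ### The structural morphisms of $A_C$ as restrictions. -/

namespace YonedaDress

open BisetCat

variable {R : Type v} [CommRing R] {Z : GroupClass.{u}}

theorem mulMap_eq_resMap (K G C : BisetCat R Z) :
    mulMap K G C =
      resMap (G := (K.prod G).prod C) (H := (K.prod C).prod (G.prod C)) (diagHom K G C) := by
  have h : (ofBiset (diagBiset G C) : C.prod (G.prod C) ⟶ G.prod C) = resMap _ :=
    ofBiset_congr (diagBiset_equiv G C)
  rw [mulMap, h, isoMap_eq_resMap, isoMap_eq_resMap, prodMap_id_resMap, resMap_comp, resMap_comp]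
  rfl

theorem oneMap_eq_resMap (C : BisetCat R Z) :
    oneMap C = resMap (G := (one R Z).prod C) (H := one R Z) (MonoidHom.fst PUnit C) :=
  rfl

/-- Naturality of the diagonal, obtained from `prod_comp_diag` by linearity in `φ` and `ψ`. -/
theorem mulMap_comp_prodMap {K K' G G' : BisetCat R Z} (C : BisetCat R Z) (φ : K ⟶ K')
    (ψ : G ⟶ G') :
    mulMap K G C ≫ prodMap (prodMap φ ψ) (𝟙 C) =
      prodMap (prodMap φ (𝟙 C)) (prodMap ψ (𝟙 C)) ≫ mulMap K' G' C := by
  rw [mulMap_eq_resMap, mulMap_eq_resMap]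
  induction φ using hom_induction with
  | zero => simp
  | add x y hx hy => simp [hx, hy]
  | smul r x hx => simp [hx]
  | h U =>
    induction ψ using hom_induction with
    | zero => simp
    | add x y hx hy => simp [hx, hy]
    | smul r x hx => simp [hx]
    | h V =>
      have h : 𝟙 C = ofBiset (FinBiset.ident C) := rfl
      rw [h]
      simp only [prodMap_ofBiset]
      exact (ofBiset_comp _ _).trans ((ofBiset_congr (prod_comp_diag C U V)).trans
        (ofBiset_comp _ _).symm)

end YonedaDress

/-! ### The Green biset functor axioms for $A_C$. -/

namespace GreenBisetData.IsGreenBisetFunctor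

open BisetCat YonedaDress

variable {R : Type v} [CommRing R] {Z : GroupClass.{u}} {A : GreenBisetData.{u, v, w} R Z}

theorem map_map (hA : A.IsGreenBisetFunctor) {G H K : BisetCat R Z} (α : G ⟶ H) (β : H ⟶ K) (x : A.obj G) :
    A.map β (A.map α x) = A.map (α ≫ β) x := by
  rw [hA.isBisetFunctor.map_comp]; rfl

theorem mul_map_left (hA : A.IsGreenBisetFunctor) {G G' H : BisetCat R Z} (φ : G ⟶ G') (a : A.obj G) (b : A.obj H) :
    A.mul G' H (A.map φ a) b = A.map (prodMap φ (𝟙 H)) (A.mul G H a b) := by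
  rw [hA.map_mul, hA.isBisetFunctor.map_id]; rfl

theorem mul_map_right (hA : A.IsGreenBisetFunctor) {G H H' : BisetCat R Z} (ψ : H ⟶ H') (a : A.obj G) (b : A.obj H) :
    A.mul G H' a (A.map ψ b) = A.map (prodMap (𝟙 G) ψ) (A.mul G H a b) := by
  rw [hA.map_mul, hA.isBisetFunctor.map_id]; rfl

theorem isBisetFunctor_yonedaDress (hA : A.IsGreenBisetFunctor) (C : BisetCat R Z) :
    IsBisetFunctor (A.yonedaDress C).toPrefunctor where
  map_id G := by
    change A.map (prodMap (𝟙 G) (𝟙 C)) = _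
    rw [prodMap_id, hA.isBisetFunctor.map_id]; rfl
  map_comp α β := by
    change A.map (prodMap (α ≫ β) (𝟙 C)) = A.map _ ≫ A.map _
    -- Interchange read backwards leaves `𝟙 C ≫ 𝟙 C` in the second factor.
    rw [← hA.isBisetFunctor.map_comp, ← prodMap_comp, Category.comp_id]
  map_add α β := by
    change A.map (prodMap (α + β) (𝟙 C)) = A.map _ + A.map _
    rw [add_prodMap, hA.isBisetFunctor.map_add]; rfl
  map_smul r α := by
    change A.map (prodMap (r • α) (𝟙 C)) = r • A.map _
    rw [smul_prodMap, hA.isBisetFunctor.map_smul]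

theorem mulMap_assoc (hA : A.IsGreenBisetFunctor) (C G H K : BisetCat R Z)
    (a : A.obj (G.prod C)) (b : A.obj (H.prod C)) (c : A.obj (K.prod C)) :
    A.map (mulMap (G.prod H) K C) (A.mul _ _ (A.map (mulMap G H C) (A.mul _ _ a b)) c) =
      A.map (prodMap (isoMap (G := G.prod (H.prod K)) (H := (G.prod H).prod K)
          (MulEquiv.prodAssoc (M := G) (N := H) (P := K)).symm) (𝟙 C))
        (A.map (mulMap G (H.prod K) C)
          (A.mul _ _ a (A.map (mulMap H K C) (A.mul _ _ b c)))) := by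
  rw [hA.mul_map_left, hA.mul_map_right, hA.mul_assoc]
  simp only [hA.map_map, mulMap_eq_resMap, isoMap_eq_resMap, prodMap_resMap_id,
    prodMap_id_resMap, resMap_comp]
  -- Both sides restrict $a\times(b\times c)$ along the same homomorphism
  -- $(((g,h),k),x)\mapsto((g,x),((h,x),(k,x)))$: the order in which $x\in C$ is duplicated does not
  -- matter.
  rfl

theorem mulMap_one_mul (hA : A.IsGreenBisetFunctor) (C G : BisetCat R Z)
    (a : A.obj (G.prod C)) :
    A.map (prodMap (isoMap (G := (BisetCat.one R Z).prod G) (H := G) MulEquiv.uniqueProd) (𝟙 C))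
      (A.map (mulMap (BisetCat.one R Z) G C) (A.mul _ _ (A.map (oneMap C) A.one) a)) = a := by
  -- It suffices to match the unit law of $A$ at $G\times C$. Inflation discards the copy of $C$
  -- created by the diagonal, so both sides restrict $\varepsilon_A\times a$ along
  -- $(g,c)\mapsto(1,(g,c))$.
  refine Eq.trans ?_ (hA.one_mul (G.prod C) a)
  rw [hA.mul_map_left]
  simp only [hA.map_map, mulMap_eq_resMap, isoMap_eq_resMap, oneMap_eq_resMap,
    prodMap_resMap_id, resMap_comp]
  rfl

theorem mulMap_mul_one (hA : A.IsGreenBisetFunctor) (C G : BisetCat R Z)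
    (a : A.obj (G.prod C)) :
    A.map (prodMap (isoMap (G := G.prod (BisetCat.one R Z)) (H := G) MulEquiv.prodUnique) (𝟙 C))
      (A.map (mulMap G (BisetCat.one R Z) C) (A.mul _ _ a (A.map (oneMap C) A.one))) = a := by
  refine Eq.trans ?_ (hA.mul_one (G.prod C) a)
  rw [hA.mul_map_right]
  simp only [hA.map_map, mulMap_eq_resMap, isoMap_eq_resMap, oneMap_eq_resMap,
    prodMap_resMap_id, prodMap_id_resMap, resMap_comp]
  rfl

/-- This is the corresponding axiom of $A$ for the morphisms $\varphi\times C$ and $\psi\times C$,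
followed by naturality of the diagonal. -/
theorem map_mulMap (hA : A.IsGreenBisetFunctor) (C : BisetCat R Z) {G G' H H' : BisetCat R Z}
    (φ : G ⟶ G') (ψ : H ⟶ H') (a : A.obj (G.prod C)) (b : A.obj (H.prod C)) :
    A.map (prodMap (prodMap φ ψ) (𝟙 C)) (A.map (mulMap G H C) (A.mul _ _ a b)) =
      A.map (mulMap G' H' C)
        (A.mul _ _ (A.map (prodMap φ (𝟙 C)) a) (A.map (prodMap ψ (𝟙 C)) b)) := by
  rw [← hA.map_mul, hA.map_map, hA.map_map, mulMap_comp_prodMap]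

end GreenBisetData.IsGreenBisetFunctor

theorem lemma4p4 {R : Type v} [CommRing R] {Z : GroupClass.{u}}
    (A : GreenBisetData.{u, v, w} R Z) (hA : A.IsGreenBisetFunctor) (C : BisetCat R Z) :
    (A.yonedaDress C).IsGreenBisetFunctor :=
  { isBisetFunctor := hA.isBisetFunctor_yonedaDress C
    mul_assoc := hA.mulMap_assoc C
    one_mul := hA.mulMap_one_mul C
    mul_one := hA.mulMap_mul_one C
    map_mul := hA.map_mulMap C }
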